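/- For $m\ge 1$ let $\mathbb Z^m=\langle a_1,\dots,a_m\rangle$ and let $G_m=\mathbb Z^m*_{g\mapsto g^3}$ be the HNN extension with stable letter $t$ and relations $tgt^{-1}=g^3$ ($g\in\mathbb Z^m$). For $g\in G_m$ let $\ell(g)$ be the word length with respect to the generators $a_1,\dots,a_m,t$. The positive series is the growth series in $G_m$ of the positive orthant $\mathbb Z_+^m=\{a_1^{v_1}\cdots a_m^{v_m} : v_i\ge 1\ \text{for all } i\}$, $$P_m(x)=\sum_{n\ge 0}\#\{g\in \mathbb Z_+^m : \ell(g)=n\}\,x^n .$$ Write $A_i=a_i^{-1}$ and $T=t^{-1}$ for formal inverse letters, and consider the following sets of words (for every $k\ge1$, in the letters $a_i, A_i$ ($1\le i\le k$), $t$, $T$): $U_k=\{a_1\cdots a_k\}$; $W_k=\{a_1^{e_1}\cdots a_k^{e_k} : e_i\in\{-1,0,1\}\}$; $V_k=\bigl(\{a_1^2\cdots a_k^2\}\cup tU_kTW_k\bigr)\setminus\{t\,a_1\cdots a_k\,T\,A_1\cdots A_k\}$; $R_k=\bigcup_{n\ge 0}t^n(TW_k)^n$. Denote by $U_k(x),V_k(x),R_k(x)$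 the power series whose coefficient of $x^n$ is the number of words of length $n$ in $U_k,V_k,R_k$ respectively. **Theorem.** For every $k\ge 1$, $$U_k(x)=x^k,\qquad V_k(x)=x^{2k}+x^{k+2}(1+2x)^k-x^{2k+2},\qquad R_k(x)=\frac{1}{1-x^2(1+2x)^k}.$$ For every $m\ge 1$, $$P_m=U_m+V_mR_m+\sum_{\substack{(i_1,\dots,i_q),\ q\ge 2\\ i_1+\cdots+i_q=m}}\binom{m}{i_1,\dots,i_q}\, V_{i_1}R_{i_1}\Bigl(\prod_{1<k<q}U_{i_k}\bigl(R_{i_1+\cdots+i_k}-1\bigr)\Bigr)U_{i_q}R_m ,$$ the sum being over all ordered partitions of $m$ into $q\ge2$ positive integers. Consequently $P_m(x)$ is rational: it is the power series expansion at $0$ of a quotient of two polynomials over $\mathbb Q$ whose denominator does not vanish at $0$. -/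

import Mathlib

open PowerSeries

namespace CubingHNN

/-! ### The group: the HNN extension of `ℤ^m` by the cubing endomorphism -/

/-- The free abelian group `ℤ^m`, written multiplicatively. -/
abbrev Zpow (m : ℕ) : Type := Multiplicative (Fin m → ℤ)

/-- The cubing endomorphism `g ↦ g ^ 3` of `ℤ^m`. -/
def cubing (m : ℕ) : Zpow m →* Zpow m := powMonoidHom 3

theorem cubing_injective (m : ℕ) : Function.Injective (cubing m) := by
  intro x y h
  have h' : (3 : ℕ) • Multiplicative.toAdd x = (3 : ℕ) • Multiplicative.toAdd y := h
  have h2 : Multiplicative.toAdd x = Multiplicative.toAdd y := by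
    funext i
    have h3 := congrFun h' i
    simp only [Pi.smul_apply, nsmul_eq_mul] at h3
    push_cast at h3
    omega
  exact h2

/-- Cubing, as an isomorphism of `ℤ^m` onto its image. -/
noncomputable def cubingEquiv (m : ℕ) : (⊤ : Subgroup (Zpow m)) ≃* (cubing m).range :=
  Subgroup.topEquiv.trans (MonoidHom.ofInjective (cubing_injective m))

/-- The HNN extension of `ℤ^m` with stable letter `t` and relations `t g t⁻¹ = g ^ 3`,
`g ∈ ℤ^m`. -/
abbrev Grp (m : ℕ) : Type :=
  HNNExtension (Zpow m) ⊤ (cubing m).range (cubingEquiv m)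

/-- The canonical embedding of the horocyclic subgroup `ℤ^m`. -/
noncomputable def horo {m : ℕ} (v : Fin m → ℤ) : Grp m :=
  HNNExtension.of (Multiplicative.ofAdd v)

/-- Check of the defining relation: `t g t⁻¹ = g ^ 3`. -/
theorem t_conj_horo {m : ℕ} (v : Fin m → ℤ) :
    (HNNExtension.t : Grp m) * horo v * (HNNExtension.t)⁻¹ = horo v ^ 3 := by
  have h := HNNExtension.equiv_eq_conj (φ := cubingEquiv m)
    ⟨Multiplicative.ofAdd v, Subgroup.mem_top _⟩
  rw [horo, ← h, ← map_pow]
  rfl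

/-! ### Spellings, spheres, growth of the positive orthant -/

/-- The letters `a_i`, `A_i = a_i⁻¹`, `t`, `T = t⁻¹`. -/
inductive Letter (m : ℕ) : Type
  | a (i : Fin m) : Letter m
  | A (i : Fin m) : Letter m
  | t : Letter m
  | T : Letter m

/-- The group element denoted by a letter. -/
noncomputable def Letter.eval {m : ℕ} : Letter m → Grp m
  | .a i => horo (Pi.single i 1)
  | .A i => (horo (Pi.single i 1))⁻¹
  | .t => HNNExtension.t
  | .T => (HNNExtension.t)⁻¹

/-- The group element spelled by a word. -/
noncomputable def evalWord {m : ℕ} (w : List (Letter m)) : Grp m :=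
  (w.map Letter.eval).prod

/-- The sphere of radius `n`: the elements whose shortest spelling in the generators
`a_1, …, a_m, t` and their inverses has length exactly `n`. -/
def sphere (m n : ℕ) : Set (Grp m) :=
  {g | IsLeast {k : ℕ | ∃ w : List (Letter m), w.length = k ∧ evalWord w = g} n}

/-- The positive orthant `ℤ_+^m` of the horocyclic subgroup (all coordinates positive). -/
def positiveOrthant (m : ℕ) : Set (Grp m) :=
  {g | ∃ v : Fin m → ℤ, (∀ i, 0 < v i) ∧ g = horo v}

instance instFiniteLetter (m : ℕ) : Finite (Letter m) := by
  let f : Letter m → (Fin m ⊕ Fin m) ⊕ Bool := fun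
    | .a i => .inl (.inl i)
    | .A i => .inl (.inr i)
    | .t => .inr true
    | .T => .inr false
  refine Finite.of_injective f ?_
  intro x y h
  cases x <;> cases y <;> simp_all [f]

/-- Spheres are finite, so the cardinalities below are genuine. -/
theorem sphere_finite (m n : ℕ) : (sphere m n).Finite := by
  refine ((List.finite_length_eq (Letter m) n).image evalWord).subset ?_
  rintro g ⟨⟨w, hw, hg⟩, -⟩
  exact ⟨w, hw, hg⟩

/-- `P_m(x)`: the growth series of the positive orthant, whose `n`-th coefficient is the number
of elements of the positive orthant of word length `n` in the whole group. -/
noncomputable def P (m : ℕ) : ℚ⟦X⟧ :=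
  PowerSeries.mk fun n => ((sphere m n ∩ positiveOrthant m).ncard : ℚ)

/-! ### The languages `U_m`, `W_m`, `V_m`, `R_m` and their growth series -/

/-- The growth series of a language: its `n`-th coefficient is the number of words of
length `n`. -/
noncomputable def langSeries {α : Type} (L : Language α) : ℚ⟦X⟧ :=
  PowerSeries.mk fun n => (({w : List α | w ∈ L ∧ w.length = n}).ncard : ℚ)

/-- The word `a_1 ⋯ a_m`. -/
def wordU (m : ℕ) : List (Letter m) := (List.finRange m).map Letter.a

/-- The word `a_1² ⋯ a_m²`. -/
def wordSq (m : ℕ) : List (Letter m) :=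
  (List.finRange m).flatMap fun i => [Letter.a i, Letter.a i]

/-- The word `A_1 ⋯ A_m`. -/
def wordUinv (m : ℕ) : List (Letter m) := (List.finRange m).map Letter.A

/-- The spelling of `a_i ^ e` for `e ∈ {-1, 0, 1}`. -/
def letterPow {m : ℕ} (i : Fin m) : SignType → List (Letter m)
  | .neg => [Letter.A i]
  | .zero => []
  | .pos => [Letter.a i]

/-- `U_m = {a_1 ⋯ a_m}`. -/
def langU (m : ℕ) : Language (Letter m) := {wordU m}

/-- `W_m = {a_1^{e_1} ⋯ a_m^{e_m} | e_i ∈ {-1, 0, 1}}`. -/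
def langW (m : ℕ) : Language (Letter m) :=
  Set.range fun e : Fin m → SignType => (List.finRange m).flatMap fun i => letterPow i (e i)

/-- `{t}` as a one-word language. -/
def langt (m : ℕ) : Language (Letter m) := {[Letter.t]}

/-- `{T}` as a one-word language. -/
def langT (m : ℕ) : Language (Letter m) := {[Letter.T]}

/-- The top-dimensional caps
`V_m = ({a_1² ⋯ a_m²} ∪ t U_m T W_m) ∖ {t a_1 ⋯ a_m T A_1 ⋯ A_m}`. -/
def langV (m : ℕ) : Language (Letter m) :=
  ({wordSq m} + langt m * langU m * langT m * langW m) -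
    (langt m * langU m * langT m * {wordUinv m})

/-- The prefix/suffix language `⋃_{n ≥ 0} t^n (T W_m)^n`. -/
def langR (m : ℕ) : Language (Letter m) :=
  ⨆ n : ℕ, langt m ^ n * (langT m * langW m) ^ n

/-- `U_m(x)`. -/
noncomputable def U (m : ℕ) : ℚ⟦X⟧ := langSeries (langU m)

/-- The cap polynomial `V_m(x)`. -/
noncomputable def V (m : ℕ) : ℚ⟦X⟧ := langSeries (langV m)

/-- The prefix/suffix series `R_m(x)`. -/
noncomputable def R (m : ℕ) : ℚ⟦X⟧ := langSeries (langR m)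

/-! ### The summands of the formula, and rationality -/

/-- The part `i_k` (`1 ≤ k ≤ q`) of an ordered partition `(i_1, …, i_q)`. -/
def part {m : ℕ} (c : Composition m) (k : ℕ) : ℕ := c.blocks.getD (k - 1) 0

/-- The summand for the ordered partition `(i_1, …, i_q)` of `m`, without its multinomial
coefficient. Here `c.sizeUpTo k = i_1 + ⋯ + i_k`. If `q = 1` there is no last `U` to attach,
and the summand is `V_m R_m`. -/
noncomputable def summand {m : ℕ} (c : Composition m) : ℚ⟦X⟧ :=
  if c.length = 1 then V m * R m
  else
    V (part c 1) * R (part c 1)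
      * (∏ k ∈ Finset.Ioo 1 c.length, U (part c k) * (R (c.sizeUpTo k) - 1))
      * (U (part c c.length) * R m)

/-- A power series is rational if it is the expansion at `0` of a quotient `p / q` of
polynomials with `q(0) ≠ 0`. -/
def IsRational (f : ℚ⟦X⟧) : Prop :=
  ∃ p q : Polynomial ℚ, q.coeff 0 ≠ 0 ∧ (q : ℚ⟦X⟧) * f = (p : ℚ⟦X⟧)

end CubingHNN

/-!
Both sides of the formula for `P_m` are determined by one recursion.

*Word length.* Moving along the stable letter multiplies `ℤ^m` by `3`, so a word is a path through
heights, and a letter `a_i` read at height `h` contributes `3 ^ h` to the `i`-th coordinate. A path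
that spells `v ∈ ℤ^m` gains nothing by descending below height `0`; if its top height is `n`, the
cheapest choice is to expand every coordinate as `∑_{h ≤ n} 3 ^ h w_h` with balanced ternary digits
below the top (`cost`), and the letters `t`, `T` cost `2 n` more. Hence the length of `v` is the
minimum over `n` of these costs (`len`, `horo_mem_sphere_iff`). The lower bound is an induction on
words (`exists_normal_form`); its arithmetic core is that changing one digit of a balanced ternary
expansion raises the cost by at most one (`cost_add_pow_le`).

*Recursion for `P_m`.* Write a positive vector as `v = 3 r + d` with digits `d_i ∈ {-1, 0, 1}`. The
coordinates with `r_i = 0` are equal to `1`; on the set `S` of the others, `r` is an arbitrary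
positive vector and `d` is arbitrary (`assemble_bijective`). Stripping the last digit computes the
length, except that it overshoots by exactly `2` when all coordinates are at most `2`. Summing over
`S` gives a recursion for `P_m` in terms of the `P_j` with `j ≤ m` (`P_recursion`).

*Recursion for the formula.* Detaching the last part of an ordered partition of `m` turns the sum
over ordered partitions into a sum over `0 < j < m` and ordered partitions of `j`. Combined with the
functional equation of `R_m`, which says that a nonempty word of `R_m` is uniquely `t w T u` with
`w ∈ R_m` and `u ∈ W_m`, this yields the recursion satisfied by `P_m - U_m`
(`compSum_recursion`, `P_sub_recursion`), whose solution is unique.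

Rationality follows from the formula, because its ingredients are rational.
-/

namespace CubingHNN

/-! ### Generating functions of weighted types -/

/-- The generating function `∑ₐ X ^ f a` of a type with weight `f`: its `n`-th coefficient is the
number of elements of weight `n`. It is meaningful when the fibres of `f` are finite; infinite
fibres are counted as `0`. -/
noncomputable def genFun {α : Type*} (f : α → ℕ) : ℚ⟦X⟧ :=
  PowerSeries.mk fun n => (Nat.card {a // f a = n} : ℚ)

/-- The weight `f` takes each value only finitely often. -/
def FiniteFibers {α : Type*} (f : α → ℕ) : Prop :=
  ∀ n, Finite {a // f a = n}

theorem FiniteFibers.comp_injective {α β : Type*} {f : α → ℕ} (hf : FiniteFibers f) {e : β → α}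
    (he : Function.Injective e) : FiniteFibers fun b => f (e b) := fun n =>
  have := hf n
  .of_injective (fun b : {b // f (e b) = n} => (⟨e b.1, b.2⟩ : {a // f a = n}))
    fun _ _ h => Subtype.ext (he (congrArg Subtype.val h))

theorem FiniteFibers.of_finite {α : Type*} [Finite α] (f : α → ℕ) : FiniteFibers f :=
  fun _ => inferInstance

theorem FiniteFibers.add_const {α : Type*} {f : α → ℕ} (hf : FiniteFibers f) (k : ℕ) :
    FiniteFibers fun a => f a + k := fun n => by
  have := hf (n - k)
  exact Finite.of_injective
    (fun b : {b // f b + k = n} => (⟨b.1, by have := b.2; omega⟩ : {a // f a = n - k}))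
    fun _ _ h => Subtype.ext (Subtype.mk.inj h)

theorem genFun_bijective {α β : Type*} {f : α → ℕ} {g : β → ℕ} (e : α → β)
    (he : Function.Bijective e) (h : ∀ a, g (e a) = f a) : genFun f = genFun g := by
  ext n
  simp only [genFun, coeff_mk]
  congr 1
  exact Nat.card_congr ((Equiv.ofBijective e he).subtypeEquiv fun a => by simp [h])

theorem genFun_sigma {ι : Type*} [Fintype ι] {α : ι → Type*} (f : ∀ i, α i → ℕ)
    (hf : ∀ i, FiniteFibers (f i)) :
    genFun (fun p : Σ i, α i => f p.1 p.2) = ∑ i, genFun (f i) := by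
  ext n
  have := fun i => hf i n
  simp only [genFun, coeff_mk, map_sum]
  rw [Nat.card_congr (β := Σ i, {a // f i a = n})
    ⟨fun p => ⟨p.1.1, p.1.2, p.2⟩, fun p => ⟨⟨p.1, p.2.1⟩, p.2.2⟩, fun _ => rfl, fun _ => rfl⟩,
    Nat.card_sigma]
  push_cast
  rfl

theorem genFun_sum {α β : Type*} (f : α → ℕ) (g : β → ℕ) (hf : FiniteFibers f)
    (hg : FiniteFibers g) : genFun (Sum.elim f g) = genFun f + genFun g := by
  ext n
  have := hf n
  have := hg n
  simp only [genFun, coeff_mk, map_add]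
  rw [Nat.card_congr (β := {a // f a = n} ⊕ {b // g b = n}) Equiv.subtypeSum, Nat.card_sum]
  push_cast
  rfl

theorem genFun_prod {α β : Type*} (f : α → ℕ) (g : β → ℕ) (hf : FiniteFibers f)
    (hg : FiniteFibers g) :
    genFun (fun p : α × β => f p.1 + g p.2) = genFun f * genFun g := by
  ext n
  have := fun n => hf n
  have := fun n => hg n
  rw [coeff_mul]
  simp only [genFun, coeff_mk]
  let e : {p : α × β // f p.1 + g p.2 = n} ≃
      Σ q : Finset.HasAntidiagonal.antidiagonal n, {a // f a = q.1.1} × {b // g b = q.1.2} :=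
    { toFun := fun p => ⟨⟨(f p.1.1, g p.1.2), by simpa using p.2⟩, ⟨p.1.1, rfl⟩, ⟨p.1.2, rfl⟩⟩
      invFun := fun p => ⟨(p.2.1.1, p.2.2.1), by
        have := p.1.2
        rw [Finset.HasAntidiagonal.mem_antidiagonal] at this
        simp [p.2.1.2, p.2.2.2, this]⟩
      left_inv := fun _ => rfl
      right_inv := by
        rintro ⟨⟨⟨a, b⟩, h⟩, ⟨x, hx⟩, ⟨y, hy⟩⟩
        obtain rfl : f x = a := hx
        obtain rfl : g y = b := hy
        rfl }
  rw [Nat.card_congr e, Nat.card_sigma]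
  simp only [Nat.card_prod]
  push_cast
  exact Finset.sum_coe_sort (Finset.HasAntidiagonal.antidiagonal n)
    fun q => (Nat.card {a // f a = q.1} : ℚ) * Nat.card {b // g b = q.2}

theorem genFun_fintype {α : Type*} [Fintype α] (f : α → ℕ) :
    genFun f = ∑ a, (X : ℚ⟦X⟧) ^ f a := by
  classical
  ext n
  simp only [genFun, coeff_mk, map_sum, coeff_X_pow, Finset.sum_boole, Nat.card_eq_fintype_card,
    Fintype.card_subtype]
  simp only [eq_comm]

theorem genFun_add_const {α : Type*} (f : α → ℕ) (k : ℕ) (hf : FiniteFibers f) :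
    genFun (fun a => f a + k) = genFun f * X ^ k := by
  have h := genFun_prod f (fun _ : Unit => k) hf (.of_finite _)
  rw [genFun_fintype (fun _ : Unit => k)] at h
  simp only [Finset.univ_unique, Finset.sum_const, Finset.card_singleton, one_smul] at h
  rw [← h]
  exact genFun_bijective (fun a => (a, ())) ⟨fun a b h => congrArg Prod.fst h, fun p => ⟨p.1, rfl⟩⟩
    fun a => rfl

/-- Vectors with coordinates in a finite type, weighted by the sum of the coordinate weights. -/
theorem genFun_pi {ι α : Type*} [Fintype ι] [Fintype α] (f : α → ℕ) :
    genFun (fun v : ι → α => ∑ i, f (v i)) = (∑ a, (X : ℚ⟦X⟧) ^ f a) ^ Fintype.card ι := by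
  classical
  rw [genFun_fintype]
  simp only [← Finset.prod_pow_eq_pow_sum]
  rw [← Finset.card_univ, ← Finset.prod_const, Finset.prod_univ_sum, Fintype.piFinset_univ]

/-- The number of letters needed to spell `a ^ e`. -/
def signLen (s : SignType) : ℕ := (s : ℤ).natAbs

theorem sum_X_pow_signLen : ∑ s : SignType, (X : ℚ⟦X⟧) ^ signLen s = 1 + 2 * X := by
  have : (Finset.univ : Finset SignType) = {0, -1, 1} := rfl
  rw [this]
  simp [signLen]
  ring

/-! ### The growth series of the languages -/

theorem finiteFibers_length {α : Type} [Finite α] (L : Language α) :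
    FiniteFibers fun w : {w // w ∈ L} => w.1.length := fun n => by
  have := (List.finite_length_eq α n).to_subtype
  exact Finite.of_injective (β := {w : List α | w.length = n}) (fun w => ⟨w.1.1, w.2⟩)
    fun _ _ h => Subtype.ext (Subtype.ext (Subtype.mk.inj h))

theorem langSeries_eq_genFun {α : Type} (L : Language α) :
    langSeries L = genFun fun w : {w // w ∈ L} => w.1.length := by
  ext n
  simp only [langSeries, genFun, coeff_mk]
  rw [← Nat.card_coe_set_eq]
  congr 1
  exact Nat.card_congr (Equiv.subtypeSubtypeEquivSubtypeInter (· ∈ L) (fun w => w.length = n)).symm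

theorem langSeries_singleton {α : Type} (w : List α) :
    langSeries ({w} : Language α) = X ^ w.length := by
  have h : genFun (fun _ : Unit => w.length) = X ^ w.length := by simp [genFun_fintype]
  rw [langSeries_eq_genFun, ← h]
  symm
  exact genFun_bijective (fun _ => ⟨w, rfl⟩)
    ⟨fun _ _ _ => rfl, fun ⟨_, hx⟩ => ⟨(), Subtype.ext (Eq.symm hx)⟩⟩ fun _ => rfl

theorem langSeries_add {α : Type} [Finite α] (L M : Language α) (h : ∀ w ∈ L, w ∉ M) :
    langSeries (L + M) = langSeries L + langSeries M := by
  simp only [langSeries_eq_genFun]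
  rw [← genFun_sum _ _ (finiteFibers_length L) (finiteFibers_length M)]
  symm
  refine genFun_bijective
    (Sum.elim (fun w => ⟨w.1, (Language.mem_add ..).2 (.inl w.2)⟩)
      (fun w => ⟨w.1, (Language.mem_add ..).2 (.inr w.2)⟩)) ⟨?_, ?_⟩ ?_
  · rintro (x | x) (y | y) hxy <;> have hxy' := congrArg Subtype.val hxy <;>
      simp only [Sum.elim_inl, Sum.elim_inr] at hxy'
    · rw [Subtype.ext hxy']
    · exact absurd (hxy' ▸ y.2) (h _ x.2)
    · exact absurd (hxy' ▸ x.2) (h _ y.2)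
    · rw [Subtype.ext hxy']
  · rintro ⟨w, hw⟩
    rcases (Language.mem_add ..).1 hw with hw | hw
    · exact ⟨.inl ⟨w, hw⟩, rfl⟩
    · exact ⟨.inr ⟨w, hw⟩, rfl⟩
  · rintro (x | x) <;> rfl

/-- The growth series of an unambiguous product of languages. -/
theorem langSeries_mul {α : Type} [Finite α] (L M : Language α)
    (h : ∀ x ∈ L, ∀ y ∈ M, ∀ x' ∈ L, ∀ y' ∈ M, x ++ y = x' ++ y' → x = x' ∧ y = y') :
    langSeries (L * M) = langSeries L * langSeries M := by
  simp only [langSeries_eq_genFun]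
  rw [← genFun_prod _ _ (finiteFibers_length L) (finiteFibers_length M)]
  symm
  refine genFun_bijective (fun p => ⟨p.1.1 ++ p.2.1, Language.append_mem_mul p.1.2 p.2.2⟩)
    ⟨?_, ?_⟩ fun p => List.length_append
  · rintro ⟨x, y⟩ ⟨x', y'⟩ hxy
    obtain ⟨h1, h2⟩ := h _ x.2 _ y.2 _ x'.2 _ y'.2 (congrArg Subtype.val hxy)
    rw [Subtype.ext h1, Subtype.ext h2]
  · rintro ⟨w, hw⟩
    obtain ⟨x, hx, y, hy, rfl⟩ := Language.mem_mul.1 hw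
    exact ⟨(⟨x, hx⟩, ⟨y, hy⟩), rfl⟩

theorem langSeries_singleton_mul {α : Type} [Finite α] (w : List α) (M : Language α) :
    langSeries ({w} * M) = X ^ w.length * langSeries M := by
  rw [langSeries_mul, langSeries_singleton]
  rintro x rfl y _ x' hx' y' _ h
  obtain rfl : x' = x := hx'
  exact ⟨rfl, List.append_cancel_left h⟩

theorem singleton_mul_singleton {α : Type} (v w : List α) :
    ({v} * {w} : Language α) = {v ++ w} := Set.image2_singleton

theorem U_eq (k : ℕ) : U k = X ^ k := by
  rw [U, langU, langSeries_singleton, wordU]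
  simp

/-- The word `a_1^{e_1} ⋯ a_m^{e_m}`. -/
def wordPow {m : ℕ} (e : Fin m → SignType) : List (Letter m) :=
  (List.finRange m).flatMap fun i => letterPow i (e i)

theorem length_letterPow {m : ℕ} (i : Fin m) (s : SignType) :
    (letterPow i s).length = signLen s := by
  cases s <;> rfl

theorem a_mem_letterPow {m : ℕ} (i j : Fin m) (s : SignType) :
    Letter.a i ∈ letterPow j s ↔ i = j ∧ s = 1 := by
  cases s <;> simp [letterPow]

theorem A_mem_letterPow {m : ℕ} (i j : Fin m) (s : SignType) :
    Letter.A i ∈ letterPow j s ↔ i = j ∧ s = -1 := by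
  cases s <;> simp [letterPow]

theorem T_notMem_wordPow {m : ℕ} (e : Fin m → SignType) : Letter.T ∉ wordPow e := by
  simp only [wordPow, List.mem_flatMap, not_exists, not_and]
  intro i _
  cases e i <;> simp [letterPow]

theorem wordPow_injective (m : ℕ) : Function.Injective (wordPow (m := m)) := by
  intro e e' h
  have h1 : ∀ i, e i = 1 ↔ e' i = 1 := fun i => by
    have := congrArg (Letter.a i ∈ ·) h
    simpa [wordPow, a_mem_letterPow] using this
  have h2 : ∀ i, e i = -1 ↔ e' i = -1 := fun i => by
    have := congrArg (Letter.A i ∈ ·) h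
    simpa [wordPow, A_mem_letterPow] using this
  funext i
  have h1 := h1 i
  have h2 := h2 i
  revert h1 h2
  generalize e i = x
  generalize e' i = y
  revert x y
  decide

theorem langSeries_langW (m : ℕ) : langSeries (langW m) = (1 + 2 * X) ^ m := by
  have h := genFun_pi (ι := Fin m) signLen
  rw [sum_X_pow_signLen, Fintype.card_fin] at h
  rw [← h, langSeries_eq_genFun]
  symm
  refine genFun_bijective (fun e => ⟨wordPow e, e, rfl⟩)
    ⟨fun e e' h => wordPow_injective m (congrArg Subtype.val h), ?_⟩ ?_
  · rintro ⟨_, e, rfl⟩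
    exact ⟨e, rfl⟩
  · intro e
    simp only [wordPow, List.length_flatMap, length_letterPow]
    exact (List.sum_ofFn (f := fun i => signLen (e i))) ▸ by rw [List.ofFn_eq_map]

theorem V_eq (k : ℕ) :
    V k = X ^ (2 * k) + X ^ (k + 2) * (1 + 2 * X) ^ k - X ^ (2 * k + 2) := by
  have hlenU : (wordU k).length = k := by simp [wordU]
  have hsq : (wordSq k).length = 2 * k := by simp [wordSq]; ring
  have hinv : (wordUinv k).length = k := by simp [wordUinv]
  have hprod : langt k * langU k * langT k = {[Letter.t] ++ wordU k ++ [Letter.T]} := by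
    rw [langt, langU, langT, singleton_mul_singleton, singleton_mul_singleton]
  have htW : Letter.t ∉ wordSq k := by simp [wordSq]
  -- The removed word does belong to `t U T W`, by taking all exponents equal to `-1`.
  have hmem : wordUinv k ∈ langW k := by
    refine ⟨fun _ => -1, ?_⟩
    change (List.finRange k).flatMap (fun i => [Letter.A i]) = _
    rw [wordUinv, List.map_eq_flatMap]
  have hsplit : langV k + {[Letter.t] ++ wordU k ++ [Letter.T] ++ wordUinv k} =
      {wordSq k} + {[Letter.t] ++ wordU k ++ [Letter.T]} * langW k := by
    rw [langV, hprod, singleton_mul_singleton]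
    refine Set.sdiff_union_of_subset ?_
    rintro _ rfl
    exact .inr (Language.append_mem_mul rfl hmem)
  have h := congrArg langSeries hsplit
  rw [langSeries_add, langSeries_add, langSeries_singleton_mul, langSeries_langW,
    langSeries_singleton, langSeries_singleton] at h
  · simp only [List.length_append, hlenU, hsq, hinv, List.length_singleton] at h
    rw [V, eq_sub_iff_add_eq]
    convert h using 2 <;> ring
  · rintro _ rfl hw
    obtain ⟨x, hx, y, hy, hxy⟩ := Language.mem_mul.1 hw
    obtain rfl := hx
    exact htW (hxy ▸ by simp)
  · rintro w hw rfl
    rw [langV, hprod, singleton_mul_singleton] at hw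
    exact hw.2 rfl

/-- The last occurrence of a letter splits a word uniquely. -/
theorem append_cons_inj_of_notMem {α : Type*} {a : α} {x x' u u' : List α} (hu : a ∉ u)
    (hu' : a ∉ u') (h : x ++ a :: u = x' ++ a :: u') : x = x' ∧ u = u' := by
  rcases List.append_eq_append_iff.1 h with ⟨z, rfl, hz⟩ | ⟨z, rfl, hz⟩ <;> cases z <;> simp_all

/-- A nonempty word of `R_m` is uniquely `t w T u` with `w ∈ R_m` and `u ∈ W_m`. -/
theorem langR_eq (m : ℕ) :
    langR m = {[]} + {[Letter.t]} * (langR m * ({[Letter.T]} * langW m)) := by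
  conv_lhs => rw [langR, ← sup_iSup_nat_succ]
  rw [langR, Language.iSup_mul, Language.mul_iSup]
  congr 1
  · simp only [pow_zero, mul_one]
    rfl
  · refine iSup_congr fun n => ?_
    rw [pow_succ', pow_succ]
    simp only [mul_assoc]
    rfl

theorem R_functional_equation (m : ℕ) : R m = 1 + X ^ 2 * (1 + 2 * X) ^ m * R m := by
  conv_lhs => rw [R, langR_eq]
  rw [langSeries_add, langSeries_singleton, langSeries_singleton_mul, langSeries_mul,
    langSeries_singleton_mul, langSeries_langW, R]
  · simp
    ring
  · rintro x _ y hy x' _ y' hy' h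
    obtain ⟨_, rfl, _, ⟨e, rfl⟩, rfl⟩ := Language.mem_mul.1 hy
    obtain ⟨_, rfl, _, ⟨e', rfl⟩, rfl⟩ := Language.mem_mul.1 hy'
    obtain ⟨h1, h2⟩ := append_cons_inj_of_notMem (T_notMem_wordPow e) (T_notMem_wordPow e') h
    exact ⟨h1, congrArg _ h2⟩
  · rintro _ rfl h
    obtain ⟨_, rfl, _, _, h⟩ := Language.mem_mul.1 h
    simp at h

theorem one_sub_mul_R (k : ℕ) : (1 - X ^ 2 * (1 + 2 * X) ^ k) * R k = 1 := by
  linear_combination R_functional_equation k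

theorem R_eq (k : ℕ) : R k = (1 - X ^ 2 * (1 + 2 * X) ^ k)⁻¹ := by
  rw [PowerSeries.eq_inv_iff_mul_eq_one, mul_comm, one_sub_mul_R]
  simp

/-! ### Balanced ternary cost of an integer -/

/-- Division by `3` rounded to the nearest integer. -/
def third (z : ℤ) : ℤ := (z + 1) / 3

/-- The last balanced ternary digit of `z`, with values in `{-1, 0, 1}`. -/
def digit (z : ℤ) : ℤ := z - 3 * third z

/-- The sum of the absolute values of the digits of `z` in the expansion `z = ∑_{h ≤ n} 3 ^ h w_h`
in which the digits `w_h` with `h < n` are balanced ternary and the top digit `w_n` is arbitrary. -/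
def cost : ℕ → ℤ → ℕ
  | 0, z => z.natAbs
  | n + 1, z => (digit z).natAbs + cost n (third z)

theorem third_add_digit (r d : ℤ) (h : -1 ≤ d) (h' : d ≤ 1) : third (3 * r + d) = r := by
  unfold third; omega

theorem digit_add (r d : ℤ) (h : -1 ≤ d) (h' : d ≤ 1) : digit (3 * r + d) = d := by
  rw [digit, third_add_digit r d h h']; ring

theorem cost_three_mul (n : ℕ) (z : ℤ) : cost (n + 1) (3 * z) = cost n z := by
  have h1 := third_add_digit z 0 (by omega) (by omega)
  have h2 := digit_add z 0 (by omega) (by omega)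
  rw [add_zero] at h1 h2
  simp [cost, h1, h2]

theorem cost_pow_mul (n p : ℕ) (z : ℤ) : cost (n + p) (3 ^ p * z) = cost n z := by
  induction p with
  | zero => simp
  | succ p ih => rw [pow_succ', mul_assoc, ← add_assoc, cost_three_mul, ih]

theorem cost_zero_right (n : ℕ) : cost n 0 = 0 := by
  simpa [cost] using cost_pow_mul 0 n 0

theorem cost_one_right (n : ℕ) : cost n 1 = 1 := by
  cases n with
  | zero => rfl
  | succ n => simpa [cost, digit, third] using cost_zero_right n

/-- The balanced ternary expansion has least cost: changing the digit in position `k` by one, and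
renormalizing, raises the cost by at most one. -/
theorem cost_add_pow_le (n k : ℕ) (hk : k ≤ n) (z s : ℤ) (hs : s = 1 ∨ s = -1) :
    cost n (z + 3 ^ k * s) ≤ cost n z + 1 := by
  induction n generalizing k z with
  | zero =>
    obtain rfl : k = 0 := by omega
    simp only [cost, pow_zero, one_mul]
    omega
  | succ n ih =>
    cases k with
    | zero =>
      simp only [cost, pow_zero, one_mul]
      -- Either there is no carry, or the digit `s` turns into `-s` and `s` is carried over.
      have hcarry : third (z + s) = third z ∨
          digit z = s ∧ digit (z + s) = -s ∧ third (z + s) = third z + s := by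
        simp only [digit, third]; omega
      rcases hcarry with h | ⟨h1, h2, h3⟩
      · rw [h]
        have : digit (z + s) = digit z + s := by simp only [digit, h]; ring
        rw [this]
        omega
      · have := ih 0 (Nat.zero_le _) (third z)
        rw [pow_zero, one_mul] at this
        rw [h1, h2, h3]
        omega
    | succ k =>
      have h1 : third (z + 3 ^ (k + 1) * s) = third z + 3 ^ k * s := by
        have : (3 : ℤ) ^ (k + 1) * s = 3 * (3 ^ k * s) := by ring
        rw [this]
        generalize (3 : ℤ) ^ k * s = y
        simp only [third]; omega
      have h2 : digit (z + 3 ^ (k + 1) * s) = digit z := by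
        rw [digit, h1, digit]; ring
      have := ih k (by omega) (third z)
      simp only [cost, h1, h2]
      omega

theorem cost_succ_le (n : ℕ) (z : ℤ) : cost (n + 1) z ≤ cost n z := by
  induction n generalizing z with
  | zero => simp only [cost, digit, third]; omega
  | succ n ih => rw [cost, cost]; exact Nat.add_le_add_left (ih _) _

/-! ### Word length of horocyclic elements -/

section WordLength

variable {m : ℕ}

theorem horo_add (v w : Fin m → ℤ) : (horo (v + w) : Grp m) = horo v * horo w := by
  simp [horo, ofAdd_add]

theorem horo_zero : (horo 0 : Grp m) = 1 := by
  simp [horo]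

theorem horo_neg (v : Fin m → ℤ) : (horo (-v) : Grp m) = (horo v)⁻¹ := by
  simp [horo, ofAdd_neg]

theorem horo_injective : Function.Injective (horo : (Fin m → ℤ) → Grp m) :=
  fun _ _ h => Multiplicative.ofAdd.injective (HNNExtension.of_injective _ h)

theorem t_mul_horo (v : Fin m → ℤ) :
    (HNNExtension.t : Grp m) * horo v = horo (3 * v) * HNNExtension.t := by
  have h : (horo (3 * v) : Grp m) = horo v ^ 3 := by
    rw [pow_succ, pow_two, ← horo_add, ← horo_add]
    congr 1
    ring
  rw [h, ← t_conj_horo]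
  group

theorem t_pow_mul_horo (k : ℕ) (v : Fin m → ℤ) :
    (HNNExtension.t : Grp m) ^ k * horo v = horo (3 ^ k * v) * HNNExtension.t ^ k := by
  induction k generalizing v with
  | zero => simp
  | succ k ih =>
    rw [pow_succ, mul_assoc, t_mul_horo, ← mul_assoc, ih, pow_succ]
    simp only [mul_assoc]

/-- The height homomorphism `G_m → ℤ`, killing `ℤ^m` and sending `t` to a generator. -/
noncomputable def height (m : ℕ) : Grp m →* Multiplicative ℤ :=
  HNNExtension.lift 1 (Multiplicative.ofAdd 1) fun _ => by simp

theorem height_horo (v : Fin m → ℤ) : height m (horo v) = 1 := by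
  simp [height, horo]

theorem height_t_pow (k : ℕ) :
    height m (HNNExtension.t ^ k) = Multiplicative.ofAdd (k : ℤ) := by
  rw [map_pow, height, HNNExtension.lift_t, ← ofAdd_nsmul]
  simp

theorem horo_mul_t_pow_eq {z v : Fin m → ℤ} {k p : ℕ}
    (h : (horo z * HNNExtension.t ^ k : Grp m) = HNNExtension.t ^ p * horo v) :
    k = p ∧ z = 3 ^ p * v := by
  have hk : k = p := by
    have := congrArg (height m) h
    rw [map_mul, map_mul, height_horo, height_horo, height_t_pow, height_t_pow, one_mul,
      mul_one] at this
    exact_mod_cast Multiplicative.ofAdd.injective this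
  refine ⟨hk, ?_⟩
  rw [t_pow_mul_horo, hk] at h
  exact horo_injective (mul_right_cancel h)

theorem sum_cost_add_single_le (N k : ℕ) (hk : k ≤ N) (z : Fin m → ℤ) (i : Fin m) (s : ℤ)
    (hs : s = 1 ∨ s = -1) :
    ∑ j, cost N ((z + 3 ^ k * Pi.single i s : Fin m → ℤ) j) ≤ ∑ j, cost N (z j) + 1 := by
  rw [← Finset.add_sum_erase _ _ (Finset.mem_univ i),
    ← Finset.add_sum_erase _ (fun j => cost N (z j)) (Finset.mem_univ i)]
  have h1 : cost N ((z + 3 ^ k * Pi.single i s : Fin m → ℤ) i) ≤ cost N (z i) + 1 := by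
    have := cost_add_pow_le N k hk (z i) s hs
    simpa using this
  have h2 : ∑ j ∈ Finset.univ.erase i, cost N ((z + 3 ^ k * Pi.single i s : Fin m → ℤ) j) =
      ∑ j ∈ Finset.univ.erase i, cost N (z j) := by
    refine Finset.sum_congr rfl fun j hj => ?_
    simp [Pi.single_eq_of_ne (Finset.ne_of_mem_erase hj)]
  omega

theorem evalWord_append (u w : List (Letter m)) : evalWord (u ++ w) = evalWord u * evalWord w := by
  simp [evalWord]

theorem evalWord_singleton (x : Letter m) : evalWord [x] = x.eval := by
  simp [evalWord]

/-- A word climbing at most to height `N - p` and descending at most to height `-p` spells some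
`t ^ (-p) * horo z * t ^ k`, and its length is bounded below by the cost of `z` plus the number of
letters `t`, `T` needed to sweep `N` levels and end at height `k - p`. -/
theorem exists_normal_form (w : List (Letter m)) :
    ∃ (N p k : ℕ) (z : Fin m → ℤ), p ≤ N ∧ k ≤ N ∧
      HNNExtension.t ^ p * evalWord w = horo z * HNNExtension.t ^ k ∧
      ((∑ i, cost N (z i) : ℕ) : ℤ) + 2 * N ≤ w.length + |(k : ℤ) - p| := by
  induction w using List.reverseRecOn with
  | nil => exact ⟨0, 0, 0, 0, le_rfl, le_rfl, by simp [evalWord, horo_zero], by simp [cost]⟩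
  | append_singleton w x ih =>
    obtain ⟨N, p, k, z, hp, hk, he, hl⟩ := ih
    have hev : (HNNExtension.t ^ p * evalWord (w ++ [x]) : Grp m) =
        horo z * HNNExtension.t ^ k * x.eval := by
      rw [evalWord_append, evalWord_singleton, ← mul_assoc, he]
    have hlen : ((w ++ [x]).length : ℤ) = w.length + 1 := by simp
    have hhoro : ∀ (i : Fin m) (s : ℤ), s = 1 ∨ s = -1 → x.eval = horo (Pi.single i s) →
        ∃ (N p k : ℕ) (z : Fin m → ℤ), p ≤ N ∧ k ≤ N ∧
          HNNExtension.t ^ p * evalWord (w ++ [x]) = horo z * HNNExtension.t ^ k ∧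
          ((∑ i, cost N (z i) : ℕ) : ℤ) + 2 * N ≤ (w ++ [x]).length + |(k : ℤ) - p| := by
      intro i s hs hx
      refine ⟨N, p, k, z + 3 ^ k * Pi.single i s, hp, hk, ?_, ?_⟩
      · rw [hev, hx, mul_assoc, t_pow_mul_horo, ← mul_assoc, horo_add]
      · have := sum_cost_add_single_le N k hk z i s hs
        rw [hlen]
        zify at this
        push_cast at hl ⊢
        linarith
    cases x with
    | a i => exact hhoro i 1 (.inl rfl) rfl
    | A i => exact hhoro i (-1) (.inr rfl) (by rw [Pi.single_neg, horo_neg]; rfl)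
    | t =>
      have hev' : (HNNExtension.t ^ p * evalWord (w ++ [Letter.t]) : Grp m) =
          horo z * HNNExtension.t ^ (k + 1) := by
        rw [hev, pow_succ, mul_assoc]; rfl
      rcases hk.lt_or_eq with hk | rfl
      · refine ⟨N, p, k + 1, z, hp, hk, hev', ?_⟩
        have := abs_sub_abs_le_abs_sub ((k : ℤ) - p) (k + 1 - p)
        have h1 : |(k : ℤ) - p - (k + 1 - p)| = 1 := by ring_nf; rfl
        rw [hlen]
        push_cast at hl ⊢
        linarith
      · refine ⟨k + 1, p, k + 1, z, by omega, le_rfl, hev', ?_⟩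
        have h1 : ∑ i, cost (k + 1) (z i) ≤ ∑ i, cost k (z i) :=
          Finset.sum_le_sum fun i _ => cost_succ_le k (z i)
        rw [hlen]
        rw [abs_of_nonneg (by omega)] at hl ⊢
        omega
    | T =>
      rcases k with _ | k
      · -- Below the lowest level visited so far: conjugate by one more `t`.
        refine ⟨N + 1, p + 1, 0, 3 * z, by omega, by omega, ?_, ?_⟩
        · rw [pow_succ', mul_assoc, hev, pow_zero, mul_one, mul_one, ← mul_assoc, t_mul_horo]
          exact mul_inv_cancel_right _ _
        · have h1 : ∑ i, cost (N + 1) ((3 * z) i) = ∑ i, cost N (z i) :=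
            Finset.sum_congr rfl fun i _ => cost_three_mul N (z i)
          rw [h1, hlen]
          rw [abs_of_nonpos (by omega)] at hl ⊢
          omega
      · refine ⟨N, p, k, z, hp, by omega, ?_, ?_⟩
        · rw [hev, pow_succ, ← mul_assoc]
          exact mul_inv_cancel_right _ _
        · have := abs_sub_abs_le_abs_sub (((k + 1 : ℕ) : ℤ) - p) (k - p)
          have h1 : |((k + 1 : ℕ) : ℤ) - p - (k - p)| = 1 := by push_cast; ring_nf; rfl
          rw [hlen]
          push_cast at hl this h1 ⊢
          linarith

theorem exists_cost_le_of_evalWord_eq {w : List (Letter m)} {v : Fin m → ℤ}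
    (h : evalWord w = horo v) : ∃ n, 2 * n + ∑ i, cost n (v i) ≤ w.length := by
  obtain ⟨N, p, k, z, hp, -, he, hl⟩ := exists_normal_form w
  rw [h] at he
  obtain ⟨rfl, rfl⟩ := horo_mul_t_pow_eq he.symm
  obtain ⟨n, rfl⟩ := Nat.exists_eq_add_of_le' hp
  refine ⟨n, ?_⟩
  have h1 : ∑ i, cost (n + k) ((3 ^ k * v : Fin m → ℤ) i) = ∑ i, cost n (v i) :=
    Finset.sum_congr rfl fun i _ => cost_pow_mul n k (v i)
  rw [h1, sub_self, abs_zero] at hl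
  push_cast at hl
  zify
  linarith

theorem exists_word_single (i : Fin m) (z : ℤ) :
    ∃ w : List (Letter m), w.length = z.natAbs ∧ evalWord w = horo (Pi.single i z) := by
  have hpow : ∀ (n : ℕ) (x : Letter m) (s : ℤ), x.eval = horo (Pi.single i s) →
      evalWord (List.replicate n x) = horo (Pi.single i (n * s)) := by
    intro n x s hx
    induction n with
    | zero => simp [evalWord, horo_zero]
    | succ n ih =>
      rw [List.replicate_succ', evalWord_append, ih, evalWord_singleton, hx, ← horo_add,
        ← Pi.single_add]
      congr 2
      push_cast
      ring
  rcases Int.natAbs_eq z with h | h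
  · refine ⟨List.replicate z.natAbs (.a i), by simp, ?_⟩
    rw [hpow _ _ 1 rfl, mul_one, ← h]
  · refine ⟨List.replicate z.natAbs (.A i), by simp, ?_⟩
    rw [hpow _ _ (-1) (by rw [Pi.single_neg, horo_neg]; rfl), mul_neg_one, ← h]

theorem exists_word_horo (v : Fin m → ℤ) :
    ∃ w : List (Letter m), w.length = ∑ i, (v i).natAbs ∧ evalWord w = horo v := by
  have h : ∀ s : Finset (Fin m), ∃ w : List (Letter m), w.length = ∑ i ∈ s, (v i).natAbs ∧
      evalWord w = horo (∑ i ∈ s, Pi.single i (v i)) := by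
    intro s
    induction s using Finset.induction_on with
    | empty => exact ⟨[], by simp, by simp [evalWord, horo_zero]⟩
    | insert i s hi ih =>
      obtain ⟨w, h1, h2⟩ := ih
      obtain ⟨u, h3, h4⟩ := exists_word_single i (v i)
      refine ⟨u ++ w, ?_, ?_⟩
      · rw [List.length_append, h1, h3, Finset.sum_insert hi]
      · rw [evalWord_append, h2, h4, Finset.sum_insert hi, horo_add]
  have := h Finset.univ
  rwa [Finset.univ_sum_single] at this

/-- The cost with `n` levels above the ground level is realized by a word of the form
`t ⋯ t u_n T u_{n-1} T ⋯ T u_0`. -/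
theorem exists_word_of_cost (n : ℕ) (v : Fin m → ℤ) :
    ∃ w : List (Letter m), w.length = 2 * n + ∑ i, cost n (v i) ∧ evalWord w = horo v := by
  induction n generalizing v with
  | zero => simpa [cost] using exists_word_horo v
  | succ n ih =>
    obtain ⟨w, h1, h2⟩ := ih fun i => third (v i)
    obtain ⟨u, h3, h4⟩ := exists_word_horo fun i => digit (v i)
    refine ⟨[.t] ++ w ++ [.T] ++ u, ?_, ?_⟩
    · simp only [List.length_append, List.length_singleton, h1, h3, cost, Finset.sum_add_distrib]
      ring
    · rw [evalWord_append, evalWord_append, evalWord_append, evalWord_singleton,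
        evalWord_singleton, h2, h4]
      change HNNExtension.t * _ * (HNNExtension.t)⁻¹ * _ = _
      rw [t_mul_horo, mul_inv_cancel_right, ← horo_add]
      congr 1
      funext i
      simp [digit]

/-- The word length in `G_m` of the horocyclic element with coordinates `v`: the least cost over
all heights that the top of the path can have. Any finite index type is allowed for the
coordinates. -/
noncomputable def len {ι : Type*} [Fintype ι] (v : ι → ℤ) : ℕ :=
  ⨅ n : ℕ, (2 * n + ∑ i, cost n (v i))

theorem len_le {ι : Type*} [Fintype ι] (v : ι → ℤ) (n : ℕ) :
    len v ≤ 2 * n + ∑ i, cost n (v i) :=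
  ciInf_le (OrderBot.bddBelow _) n

theorem exists_len_eq {ι : Type*} [Fintype ι] (v : ι → ℤ) :
    ∃ n, len v = 2 * n + ∑ i, cost n (v i) := by
  obtain ⟨n, hn⟩ := Nat.sInf_mem (Set.range_nonempty fun n : ℕ => 2 * n + ∑ i, cost n (v i))
  exact ⟨n, hn.symm⟩

theorem horo_mem_sphere_iff (v : Fin m → ℤ) (n : ℕ) : horo v ∈ sphere m n ↔ len v = n := by
  have h : IsLeast {k : ℕ | ∃ w : List (Letter m), w.length = k ∧ evalWord w = horo v} (len v) := by
    constructor
    · obtain ⟨n, hn⟩ := exists_len_eq v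
      rw [hn]
      exact exists_word_of_cost n v
    · rintro _ ⟨w, rfl, hw⟩
      obtain ⟨n, hn⟩ := exists_cost_le_of_evalWord_eq hw
      exact (len_le v n).trans hn
  exact ⟨fun h' => h.unique h', fun h' => h' ▸ h⟩

end WordLength

/-! ### The recursion for the positive series -/

/-- Vectors with positive coordinates. -/
abbrev PosVec (ι : Type*) : Type _ := {v : ι → ℤ // ∀ i, 0 < v i}

/-- The weight of `v` obtained by stripping one balanced ternary digit from each coordinate, that
is, the least length of a spelling `t u T w` in which `u` spells an element of `ℤ^m` and `w` spells
the digits. -/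
noncomputable def strippedLen {ι : Type*} [Fintype ι] (v : ι → ℤ) : ℕ :=
  2 + ∑ i, (digit (v i)).natAbs + len fun i => third (v i)

section Recursion

variable {ι : Type*}

theorem len_le_sum [Fintype ι] (v : ι → ℤ) : len v ≤ ∑ i, (v i).natAbs := by
  simpa [cost] using len_le v 0

theorem len_le_strippedLen [Fintype ι] (v : ι → ℤ) : len v ≤ strippedLen v := by
  obtain ⟨n, hn⟩ := exists_len_eq fun i => third (v i)
  have := len_le v (n + 1)
  simp only [cost, Finset.sum_add_distrib] at this
  rw [strippedLen, hn]
  omega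

theorem len_eq_sum_or_eq_strippedLen [Fintype ι] (v : ι → ℤ) :
    len v = ∑ i, (v i).natAbs ∨ len v = strippedLen v := by
  obtain ⟨n, hn⟩ := exists_len_eq v
  cases n with
  | zero => left; simpa [cost] using hn
  | succ n =>
    right
    refine (len_le_strippedLen v).antisymm ?_
    have := len_le (fun i => third (v i)) n
    simp only [cost, Finset.sum_add_distrib] at hn
    rw [hn, strippedLen]
    omega

theorem len_of_le_one [Fintype ι] {r : ι → ℤ} (h : ∀ i, r i = 0 ∨ r i = 1) :
    len r = ∑ i, (r i).natAbs := by
  refine (len_le_sum r).antisymm ?_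
  obtain ⟨n, hn⟩ := exists_len_eq r
  rw [hn]
  refine le_add_left (Finset.sum_le_sum fun i _ => ?_)
  rcases h i with h | h <;> simp [h, cost_one_right]

theorem strippedLen_of_le_two [Fintype ι] {v : ι → ℤ} (h0 : ∀ i, 0 < v i) (h : ∀ i, v i ≤ 2) :
    strippedLen v = ∑ i, (v i).natAbs + 2 := by
  rw [strippedLen, len_of_le_one, add_assoc, ← Finset.sum_add_distrib, add_comm]
  · congr 1
    refine Finset.sum_congr rfl fun i _ => ?_
    have := h0 i
    have := h i
    simp only [digit, third]
    omega
  · intro i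
    have := h0 i
    have := h i
    simp only [third]
    omega

theorem len_of_le_two [Fintype ι] {v : ι → ℤ} (h0 : ∀ i, 0 < v i) (h : ∀ i, v i ≤ 2) :
    len v = ∑ i, (v i).natAbs := by
  have h1 := strippedLen_of_le_two h0 h
  have h2 := len_le_sum v
  rcases len_eq_sum_or_eq_strippedLen v with h3 | h3 <;> omega

/-- A coordinate that is at least `3` makes it worthwhile to climb: replacing `a_i ^ 3` by
`t a_i T` already pays for the two letters `t`, `T`. -/
theorem len_of_exists_three_le [Fintype ι] {v : ι → ℤ} (h0 : ∀ i, 0 < v i) (h : ∃ i, 3 ≤ v i) :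
    len v = strippedLen v := by
  rcases len_eq_sum_or_eq_strippedLen v with h3 | h3
  · refine (len_le_strippedLen v).antisymm ?_
    rw [h3, strippedLen]
    classical
    obtain ⟨i, hi⟩ := h
    have h1 := len_le_sum fun i => third (v i)
    have h2 : ∑ j, ((digit (v j)).natAbs + (third (v j)).natAbs + if i = j then 2 else 0) ≤
        ∑ j, (v j).natAbs := by
      refine Finset.sum_le_sum fun j _ => ?_
      have := h0 j
      simp only [digit, third]
      split_ifs with hij
      · subst hij
        omega
      · omega
    simp only [Finset.sum_add_distrib, Finset.sum_ite_eq, Finset.mem_univ, if_true] at h2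
    omega
  · exact h3

theorem len_comp_equiv {κ : Type*} [Fintype ι] [Fintype κ] (e : κ ≃ ι) (v : ι → ℤ) :
    len (fun j => v (e j)) = len v :=
  iInf_congr fun n => by rw [Equiv.sum_comp e fun i => cost n (v i)]

/-- The positive series with coordinates indexed by an arbitrary finite type. -/
noncomputable def posSeries (ι : Type*) [Fintype ι] : ℚ⟦X⟧ :=
  genFun fun v : PosVec ι => len v.1

/-- Restriction of the domain along a bijection of index types. -/
def PosVec.reindex {κ : Type*} (e : κ ≃ ι) (v : PosVec ι) : PosVec κ :=
  ⟨fun j => v.1 (e j), fun j => v.2 (e j)⟩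

theorem PosVec.reindex_bijective {κ : Type*} (e : κ ≃ ι) :
    Function.Bijective (PosVec.reindex e) := by
  constructor
  · intro v w h
    refine Subtype.ext (funext fun i => ?_)
    have := congrFun (congrArg Subtype.val h) (e.symm i)
    simpa [reindex] using this
  · intro v
    exact ⟨v.reindex e.symm, Subtype.ext (funext fun i => by simp [reindex])⟩

theorem posSeries_congr {κ : Type*} [Fintype ι] [Fintype κ] (e : κ ≃ ι) :
    posSeries ι = posSeries κ :=
  genFun_bijective (PosVec.reindex e) (PosVec.reindex_bijective e) fun v => len_comp_equiv e v.1

theorem finiteFibers_len (ι : Type*) [Fintype ι] : FiniteFibers fun v : PosVec ι => len v.1 := by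
  intro n
  let e := (Fintype.equivFin ι).symm
  have := (sphere_finite (Fintype.card ι) n).to_subtype
  refine Finite.of_injective (β := sphere (Fintype.card ι) n)
    (fun v => ⟨horo (v.1.reindex e).1, ?_⟩) ?_
  · rw [horo_mem_sphere_iff]
    exact (len_comp_equiv e v.1.1).trans v.2
  · intro v w h
    exact Subtype.ext ((PosVec.reindex_bijective e).1
      (Subtype.ext (horo_injective (Subtype.mk.inj h))))

theorem P_eq_posSeries (m : ℕ) : P m = posSeries (Fin m) := by
  ext n
  simp only [P, posSeries, genFun, coeff_mk, ← Nat.card_coe_set_eq]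
  congr 1
  symm
  refine Nat.card_congr (Equiv.ofBijective
    (fun v : {v : PosVec (Fin m) // len v.1 = n} => (⟨horo v.1.1,
      (horo_mem_sphere_iff _ _).2 v.2, v.1.1, v.1.2, rfl⟩ : ↥(sphere m n ∩ positiveOrthant m)))
    ⟨?_, ?_⟩)
  · intro v w h
    exact Subtype.ext (Subtype.ext (horo_injective (Subtype.mk.inj h)))
  · rintro ⟨_, hs, v, hv, rfl⟩
    exact ⟨⟨⟨v, hv⟩, (horo_mem_sphere_iff _ _).1 hs⟩, rfl⟩

theorem finiteFibers_strippedLen (ι : Type*) [Fintype ι] :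
    FiniteFibers fun v : PosVec ι => strippedLen v.1 := by
  intro n
  have := finiteFibers_len ι n
  have := finiteFibers_len ι (n - 2)
  refine Finite.of_injective (β := {v : PosVec ι // len v.1 = n} ⊕
    {v : PosVec ι // len v.1 = n - 2})
    (fun v => if h : ∀ i, v.1.1 i ≤ 2 then .inr ⟨v.1, ?_⟩ else .inl ⟨v.1, ?_⟩) ?_
  · have h1 := (strippedLen_of_le_two v.1.2 h).symm.trans v.2
    rw [len_of_le_two v.1.2 h]
    omega
  · push Not at h
    exact (len_of_exists_three_le v.1.2 h).trans v.2
  · intro v w h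
    dsimp only at h
    split_ifs at h <;> simp only [Sum.inl.injEq, Sum.inr.injEq, Subtype.mk.injEq] at h <;>
      exact Subtype.ext h

/-- The generating function of the vectors all of whose coordinates are `1` or `2`. -/
theorem genFun_small (ι : Type*) [Fintype ι] :
    genFun (fun v : {v : PosVec ι // ∀ i, v.1 i ≤ 2} => ∑ i, (v.1.1 i).natAbs) =
      (X + X ^ 2) ^ Fintype.card ι := by
  have h := genFun_pi (ι := ι) fun b : Bool => if b then 1 else 2
  simp only [Fintype.sum_bool, if_true, Bool.false_eq_true, if_false, pow_one] at h
  rw [← h]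
  symm
  refine genFun_bijective (fun b => ⟨⟨fun i => if b i then 1 else 2, fun i => ?_⟩, fun i => ?_⟩)
    ⟨?_, ?_⟩ ?_
  · dsimp only; split_ifs <;> decide
  · dsimp only; split_ifs <;> decide
  · intro b c h
    funext i
    have := congrFun (Subtype.mk.inj (Subtype.mk.inj h)) i
    cases hb : b i <;> cases hc : c i <;> simp_all
  · rintro ⟨⟨v, h0⟩, h2⟩
    refine ⟨fun i => decide (v i = 1), Subtype.ext (Subtype.ext (funext fun i => ?_))⟩
    have := h0 i
    have : v i ≤ 2 := h2 i
    by_cases h : v i = 1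
    · simp [h]
    · simp only [h, decide_false, Bool.false_eq_true, if_false]
      omega
  · intro b
    refine Finset.sum_congr rfl fun i _ => ?_
    dsimp only
    split_ifs <;> rfl

theorem posSeries_eq_strippedLen (ι : Type*) [Fintype ι] :
    posSeries ι = genFun (fun v : PosVec ι => strippedLen v.1) +
      (1 - X ^ 2) * (X + X ^ 2) ^ Fintype.card ι := by
  classical
  have hsplit : ∀ f : PosVec ι → ℕ, FiniteFibers f → genFun f =
      genFun (fun v : {v : PosVec ι // ∀ i, v.1 i ≤ 2} => f v.1) +
        genFun (fun v : {v : PosVec ι // ¬ ∀ i, v.1 i ≤ 2} => f v.1) := by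
    intro f hf
    rw [← genFun_sum _ _ (hf.comp_injective Subtype.val_injective)
      (hf.comp_injective Subtype.val_injective)]
    symm
    refine genFun_bijective (Equiv.sumCompl _) (Equiv.bijective _) ?_
    rintro (v | v) <;> rfl
  have hfin := (finiteFibers_len ι).comp_injective
    (Subtype.val_injective (p := fun v : PosVec ι => ∀ i, v.1 i ≤ 2))
  rw [posSeries, hsplit _ (finiteFibers_len ι), hsplit _ (finiteFibers_strippedLen ι)]
  have h1 : (fun v : {v : PosVec ι // ∀ i, v.1 i ≤ 2} => len v.1.1) =
      fun v => ∑ i, (v.1.1 i).natAbs := funext fun v => len_of_le_two v.1.2 v.2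
  have h2 : (fun v : {v : PosVec ι // ∀ i, v.1 i ≤ 2} => strippedLen v.1.1) =
      fun v => ∑ i, (v.1.1 i).natAbs + 2 := funext fun v => strippedLen_of_le_two v.1.2 v.2
  have h3 : (fun v : {v : PosVec ι // ¬ ∀ i, v.1 i ≤ 2} => len v.1.1) =
      fun v => strippedLen v.1.1 := funext fun v =>
    len_of_exists_three_le v.1.2 (by have := v.2; push Not at this; exact this)
  rw [h1, h2, h3, genFun_add_const _ _ (h1 ▸ hfin), genFun_small]
  ring

/-- The positive vector whose coordinates outside `S` are `1`, and whose coordinate at `i ∈ S` has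
last balanced ternary digit `d i` and remaining part `r i > 0`. -/
def assemble [DecidableEq ι]
    (p : Σ S : Finset ι, PosVec S × (S → SignType)) : PosVec ι :=
  ⟨fun i => if h : i ∈ p.1 then 3 * p.2.1.1 ⟨i, h⟩ + p.2.2 ⟨i, h⟩ else 1, fun i => by
    dsimp only
    split_ifs with h
    · have := p.2.1.2 ⟨i, h⟩
      cases p.2.2 ⟨i, h⟩ <;> simp <;> omega
    · exact one_pos⟩

theorem signType_intCast_mem (s : SignType) : -1 ≤ (s : ℤ) ∧ (s : ℤ) ≤ 1 := by
  cases s <;> decide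

theorem third_assemble [DecidableEq ι] (p : Σ S : Finset ι, PosVec S × (S → SignType)) (i : ι) :
    third ((assemble p).1 i) = if h : i ∈ p.1 then p.2.1.1 ⟨i, h⟩ else 0 := by
  simp only [assemble]
  split_ifs with h
  · exact third_add_digit _ _ (signType_intCast_mem _).1 (signType_intCast_mem _).2
  · rfl

theorem digit_assemble [DecidableEq ι] (p : Σ S : Finset ι, PosVec S × (S → SignType)) (i : ι) :
    digit ((assemble p).1 i) = if h : i ∈ p.1 then (p.2.2 ⟨i, h⟩ : ℤ) else 1 := by
  simp only [assemble]
  split_ifs with h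
  · exact digit_add _ _ (signType_intCast_mem _).1 (signType_intCast_mem _).2
  · rfl

theorem assemble_bijective [Fintype ι] [DecidableEq ι] :
    Function.Bijective (assemble (ι := ι)) := by
  constructor
  · rintro p q h
    have h3 : ∀ i, (if h : i ∈ p.1 then p.2.1.1 ⟨i, h⟩ else 0) =
        (if h : i ∈ q.1 then q.2.1.1 ⟨i, h⟩ else 0) := fun i => by
      rw [← third_assemble, ← third_assemble, h]
    have hd : ∀ i, (if h : i ∈ p.1 then (p.2.2 ⟨i, h⟩ : ℤ) else 1) =
        (if h : i ∈ q.1 then (q.2.2 ⟨i, h⟩ : ℤ) else 1) := fun i => by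
      rw [← digit_assemble, ← digit_assemble, h]
    obtain ⟨S, r, d⟩ := p
    obtain ⟨S', r', d'⟩ := q
    dsimp only at h3 hd
    -- The set `S` is recovered as the support of the vector of remaining parts.
    obtain rfl : S = S' := by
      ext i
      have := h3 i
      split_ifs at this with h1 h2 h2
      · simp [h1, h2]
      · exact absurd this (r.2 _).ne'
      · exact absurd this.symm (r'.2 _).ne'
      · simp [h1, h2]
    obtain rfl : r = r' := Subtype.ext (funext fun i => by simpa using h3 i)
    obtain rfl : d = d' := funext fun i => by
      have := hd i
      simp only [i.2, dif_pos] at this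
      revert this
      change ((d i : ℤ) = d' i) → _
      generalize d i = x
      generalize d' i = y
      revert x y
      decide
    rfl
  · intro v
    refine ⟨⟨Finset.univ.filter fun i => 1 < v.1 i, ⟨fun i => third (v.1 i), fun i => ?_⟩,
      fun i => SignType.sign (digit (v.1 i))⟩, Subtype.ext (funext fun i => ?_)⟩
    · have := (Finset.mem_filter.1 i.2).2
      simp only [third]
      omega
    · have h0 := v.2 i
      by_cases h : 1 < v.1 i
      · have hs : ∀ z : ℤ, -1 ≤ z → z ≤ 1 → (SignType.sign z : ℤ) = z := by
          intro z h1 h2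
          interval_cases z <;> rfl
        simp only [assemble, Finset.mem_filter, Finset.mem_univ, true_and, h, dif_pos]
        rw [hs _ (by simp only [digit, third]; omega) (by simp only [digit, third]; omega), digit]
        ring
      · simp only [assemble, Finset.mem_filter, Finset.mem_univ, true_and, h, dif_neg,
          not_false_eq_true]
        omega

theorem sum_dite_mem [Fintype ι] [DecidableEq ι] (S : Finset ι) (f : S → ℕ) (c : ℕ) :
    ∑ i, (if h : i ∈ S then f ⟨i, h⟩ else c) =
      ∑ i, f i + (Fintype.card ι - S.card) * c := by
  rw [← Finset.sum_add_sum_compl S]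
  congr 1
  · rw [← Finset.sum_coe_sort]
    exact Finset.sum_congr rfl fun i _ => by simp
  · rw [← Finset.card_compl, ← smul_eq_mul, ← Finset.sum_const]
    exact Finset.sum_congr rfl fun i hi => by rw [dif_neg (Finset.mem_compl.1 hi)]

theorem strippedLen_assemble [Fintype ι] [DecidableEq ι]
    (p : Σ S : Finset ι, PosVec S × (S → SignType)) :
    strippedLen (assemble p).1 =
      (len p.2.1.1 + ∑ i, signLen (p.2.2 i)) + (2 + (Fintype.card ι - p.1.card)) := by
  have h1 : ∑ i, (digit ((assemble p).1 i)).natAbs =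
      ∑ i, signLen (p.2.2 i) + (Fintype.card ι - p.1.card) := by
    have := sum_dite_mem p.1 (fun i => signLen (p.2.2 i)) 1
    rw [mul_one] at this
    rw [← this]
    refine Finset.sum_congr rfl fun i _ => ?_
    rw [digit_assemble]
    split_ifs <;> rfl
  have h2 : len (fun i => third ((assemble p).1 i)) = len p.2.1.1 := by
    refine iInf_congr fun n => ?_
    have := sum_dite_mem p.1 (fun i => cost n (p.2.1.1 i)) 0
    rw [mul_zero, add_zero] at this
    rw [← this]
    congr 1
    refine Finset.sum_congr rfl fun i _ => ?_
    dsimp only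
    rw [third_assemble]
    split_ifs
    · rfl
    · exact cost_zero_right n
  rw [strippedLen, h1, h2]
  ring

theorem genFun_strippedLen (ι : Type*) [Fintype ι] :
    genFun (fun v : PosVec ι => strippedLen v.1) =
      ∑ S : Finset ι, posSeries S * (1 + 2 * X) ^ S.card * X ^ (2 + (Fintype.card ι - S.card)) := by
  classical
  have hf : ∀ S : Finset ι, FiniteFibers fun q : PosVec S × (S → SignType) =>
      len q.1.1 + ∑ i, signLen (q.2 i) := by
    intro S n
    have := fun k => finiteFibers_len S k
    refine Finite.of_injective (β := Σ k : Fin (n + 1), {v : PosVec S // len v.1 = k} ×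
      (S → SignType)) (fun q =>
        ⟨⟨len q.1.1.1, by have := q.2; dsimp only at this; omega⟩, ⟨q.1.1, rfl⟩, q.1.2⟩) ?_
    rintro ⟨⟨v, d⟩, h⟩ ⟨⟨v', d'⟩, h'⟩ heq
    have h1 := congrArg (fun x => x.2.1.1) heq
    have h2 := congrArg (fun x => x.2.2) heq
    dsimp only at h1 h2
    subst h1 h2
    rfl
  rw [← genFun_bijective (f := fun p : Σ S : Finset ι, PosVec S × (S → SignType) =>
    (len p.2.1.1 + ∑ i, signLen (p.2.2 i)) + (2 + (Fintype.card ι - p.1.card)))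
    assemble assemble_bijective strippedLen_assemble]
  rw [genFun_sigma (fun (S : Finset ι) (q : PosVec S × (S → SignType)) =>
    (len q.1.1 + ∑ i, signLen (q.2 i)) + (2 + (Fintype.card ι - S.card)))
    fun S => (hf S).add_const _]
  refine Finset.sum_congr rfl fun S _ => ?_
  rw [genFun_add_const _ _ (hf S), genFun_prod (fun v : PosVec S => len v.1)
    (fun d : S → SignType => ∑ i, signLen (d i)) (finiteFibers_len S) (.of_finite _), genFun_pi,
    sum_X_pow_signLen, Fintype.card_coe, posSeries]

end Recursion

/-- Stripping one balanced ternary digit: `j` is the number of coordinates that survive, the other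
`m - j` coordinates being equal to `1`. The last term corrects the weight of the vectors with all
coordinates at most `2`, for which stripping a digit wastes the letters `t` and `T`. -/
theorem P_recursion (m : ℕ) :
    P m = ∑ j ∈ Finset.range (m + 1),
        (m.choose j : ℚ⟦X⟧) * (P j * (1 + 2 * X) ^ j * X ^ (2 + (m - j))) +
      (1 - X ^ 2) * (X + X ^ 2) ^ m := by
  rw [P_eq_posSeries, posSeries_eq_strippedLen, genFun_strippedLen, Fintype.card_fin]
  congr 1
  have h : ∀ S : Finset (Fin m), posSeries S = P S.card := fun S => by
    rw [P_eq_posSeries]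
    exact posSeries_congr (S.equivFin).symm
  simp only [h]
  have := Finset.sum_powerset_apply_card
    (fun j => P j * (1 + 2 * X) ^ j * X ^ (2 + (m - j))) (x := (Finset.univ : Finset (Fin m)))
  simpa using this

/-! ### Sums over compositions -/

/-- Appending the last block `m - j` to a composition of `j < m`. -/
def appendLast {m : ℕ} (p : Σ j : Fin m, Composition j) : Composition m where
  blocks := p.2.blocks ++ [m - p.1]
  blocks_pos := by
    intro i hi
    rcases List.mem_append.1 hi with hi | hi
    · exact p.2.blocks_pos hi
    · have := p.1.2
      rw [List.mem_singleton.1 hi]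
      omega
  blocks_sum := by
    have := p.1.2
    rw [List.sum_append, p.2.blocks_sum, List.sum_singleton]
    omega

theorem appendLast_bijective {m : ℕ} (hm : 1 ≤ m) :
    Function.Bijective (appendLast (m := m)) := by
  constructor
  · rintro ⟨i, c⟩ ⟨j, d⟩ h
    have hb : c.blocks = d.blocks :=
      (List.append_inj_left' (congrArg Composition.blocks h) rfl)
    obtain rfl : i = j := Fin.ext (by rw [← c.blocks_sum, ← d.blocks_sum, hb])
    rw [Composition.ext hb]
  · intro c
    have hne : c.blocks ≠ [] := by
      rw [Ne, Composition.blocks_eq_nil]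
      omega
    have hsplit := List.dropLast_append_getLast hne
    have hlast := c.blocks_pos (List.getLast_mem hne)
    have hsum : c.blocks.dropLast.sum + c.blocks.getLast hne = m := by
      have := congrArg List.sum hsplit
      rwa [List.sum_append, List.sum_singleton, c.blocks_sum] at this
    refine ⟨⟨⟨c.blocks.dropLast.sum, by omega⟩, ⟨c.blocks.dropLast,
      fun hi => c.blocks_pos (List.mem_of_mem_dropLast hi), rfl⟩⟩, Composition.ext ?_⟩
    change c.blocks.dropLast ++ [m - c.blocks.dropLast.sum] = c.blocks
    conv_rhs => rw [← hsplit]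
    congr 2
    omega

section AppendLast

variable {m : ℕ} (p : Σ j : Fin m, Composition j)

theorem length_appendLast : (appendLast p).length = p.2.length + 1 := by
  simp [appendLast, Composition.length]

theorem part_appendLast {k : ℕ} (hk : 1 ≤ k) (hk' : k ≤ p.2.length) :
    part (appendLast p) k = part p.2 k := by
  have : k - 1 < p.2.blocks.length := by rw [Composition.blocks_length]; omega
  simp only [part, appendLast]
  rw [List.getD_append _ _ _ _ this]

theorem part_appendLast_last : part (appendLast p) (p.2.length + 1) = m - p.1 := by
  simp only [part, appendLast, Nat.add_sub_cancel]
  rw [List.getD_append_right _ _ _ _ le_rfl]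
  simp

theorem sizeUpTo_appendLast {k : ℕ} (hk' : k ≤ p.2.length) :
    (appendLast p).sizeUpTo k = p.2.sizeUpTo k := by
  simp only [Composition.sizeUpTo, appendLast]
  rw [List.take_append_of_le_length hk']

theorem prod_factorial_blocksFun {n : ℕ} (c : Composition n) :
    ∏ i, (c.blocksFun i).factorial = (c.blocks.map Nat.factorial).prod := by
  conv_rhs => rw [← c.ofFn_blocksFun, List.map_ofFn, List.prod_ofFn]
  rfl

theorem multinomial_appendLast :
    Nat.multinomial Finset.univ (appendLast p).blocksFun =
      m.choose p.1 * Nat.multinomial Finset.univ p.2.blocksFun := by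
  have h1 := Nat.multinomial_spec Finset.univ (appendLast p).blocksFun
  have h2 := Nat.multinomial_spec Finset.univ p.2.blocksFun
  have h3 := Nat.choose_mul_factorial_mul_factorial p.1.2.le
  rw [prod_factorial_blocksFun, Composition.sum_blocksFun] at h1 h2
  have h4 : ((appendLast p).blocks.map Nat.factorial).prod =
      (p.2.blocks.map Nat.factorial).prod * (m - p.1).factorial := by
    simp [appendLast]
  have h5 : 0 < ((appendLast p).blocks.map Nat.factorial).prod := by
    rw [← prod_factorial_blocksFun]
    exact Finset.prod_pos fun i _ => Nat.factorial_pos _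
  refine Nat.eq_of_mul_eq_mul_left h5 ?_
  rw [h1, h4, ← h3, ← h2]
  ring

end AppendLast

/-- The contribution of the first blocks of an ordered partition, before the last one is attached:
`V_{i_1} R_{i_1} ∏_{1 < k ≤ q} U_{i_k} (R_{i_1 + ⋯ + i_k} - 1)`. -/
noncomputable def headSummand {m : ℕ} (c : Composition m) : ℚ⟦X⟧ :=
  V (part c 1) * R (part c 1)
    * ∏ k ∈ Finset.Ioc 1 c.length, U (part c k) * (R (c.sizeUpTo k) - 1)

section

variable {m : ℕ} (p : Σ j : Fin m, Composition j)

theorem summand_appendLast_of_eq_zero (hp : (p.1 : ℕ) = 0) :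
    summand (appendLast p) = V m * R m := by
  have h : p.2.length = 0 := p.2.length_eq_zero.2 hp
  rw [summand, length_appendLast, h, if_pos rfl]

theorem summand_appendLast (hp : (p.1 : ℕ) ≠ 0) :
    summand (appendLast p) = headSummand p.2 * (X ^ (m - p.1) * R m) := by
  have h : 1 ≤ p.2.length := p.2.length_pos_iff.2 (Nat.pos_of_ne_zero hp)
  rw [summand, length_appendLast, if_neg (by omega), headSummand, part_appendLast_last, U_eq,
    part_appendLast p le_rfl h]
  congr 2
  refine Finset.prod_congr (by ext k; simp) fun k hk => ?_
  rw [Finset.mem_Ioc] at hk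
  rw [part_appendLast p hk.1.le hk.2, sizeUpTo_appendLast p hk.2]

theorem headSummand_appendLast_of_eq_zero (hp : (p.1 : ℕ) = 0) :
    headSummand (appendLast p) = V m * R m := by
  have h : p.2.length = 0 := p.2.length_eq_zero.2 hp
  have hpart := part_appendLast_last p
  rw [h, hp] at hpart
  rw [headSummand, length_appendLast, h, hpart]
  simp

theorem headSummand_appendLast (hp : (p.1 : ℕ) ≠ 0) :
    headSummand (appendLast p) = headSummand p.2 * (X ^ (m - p.1) * (R m - 1)) := by
  have h : 1 ≤ p.2.length := p.2.length_pos_iff.2 (Nat.pos_of_ne_zero hp)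
  have hsize : (appendLast p).sizeUpTo (p.2.length + 1) = m := by
    rw [← length_appendLast, Composition.sizeUpTo_length]
  rw [headSummand, length_appendLast, part_appendLast p le_rfl h,
    Finset.prod_Ioc_succ_top h, hsize, part_appendLast_last, U_eq, headSummand, mul_assoc (_ * _)]
  congr 2
  refine Finset.prod_congr rfl fun k hk => ?_
  rw [Finset.mem_Ioc] at hk
  rw [part_appendLast p hk.1.le hk.2, sizeUpTo_appendLast p hk.2]

end

/-- A sum over ordered partitions, weighted by multinomial coefficients, organized by the last
block. -/
theorem sum_composition_eq {m : ℕ} (hm : 1 ≤ m) (f : Composition m → ℚ⟦X⟧)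
    (g : ∀ j, Composition j → ℚ⟦X⟧) (a b : ℚ⟦X⟧)
    (h0 : ∀ p : Σ j : Fin m, Composition j, (p.1 : ℕ) = 0 → f (appendLast p) = a)
    (h1 : ∀ p : Σ j : Fin m, Composition j, (p.1 : ℕ) ≠ 0 →
      f (appendLast p) = g p.1 p.2 * (X ^ (m - p.1) * b)) :
    ∑ c : Composition m, (Nat.multinomial Finset.univ c.blocksFun : ℚ⟦X⟧) * f c =
      a + (∑ j ∈ Finset.Ioo 0 m, (m.choose j : ℚ⟦X⟧) * X ^ (m - j) *
        ∑ c : Composition j, (Nat.multinomial Finset.univ c.blocksFun : ℚ⟦X⟧) * g j c) * b := by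
  rw [← (appendLast_bijective hm).sum_comp, Fintype.sum_sigma]
  simp only [multinomial_appendLast]
  have hterm : ∀ j : Fin m, ∑ c : Composition j, ((m.choose j *
      Nat.multinomial Finset.univ c.blocksFun : ℕ) : ℚ⟦X⟧) * f (appendLast ⟨j, c⟩) =
      (fun j : ℕ => if j = 0 then a else (m.choose j : ℚ⟦X⟧) * X ^ (m - j) *
        (∑ c : Composition j, (Nat.multinomial Finset.univ c.blocksFun : ℚ⟦X⟧) * g j c) * b) j := by
    rintro ⟨j, hj⟩
    dsimp only
    split_ifs with h
    · subst h
      simp only [h0 ⟨⟨0, hj⟩, _⟩ rfl]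
      let _ : Unique (Composition 0) := ⟨inferInstance, fun c => Composition.ext
        ((c.blocks_eq_nil.2 rfl).trans (Composition.blocks_eq_nil _ |>.2 rfl).symm)⟩
      rw [Fintype.sum_unique]
      have : Nat.multinomial Finset.univ (default : Composition 0).blocksFun = 1 := by
        rw [Nat.multinomial, Composition.sum_blocksFun, prod_factorial_blocksFun,
          (Composition.blocks_eq_nil _).2 rfl]
        simp
      simp [this]
    · rw [Finset.mul_sum, Finset.sum_mul]
      refine Finset.sum_congr rfl fun c _ => ?_
      rw [h1 ⟨⟨j, hj⟩, c⟩ h]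
      push_cast
      ring
  rw [Finset.sum_congr rfl fun j _ => hterm j, Fin.sum_univ_eq_sum_range
    (fun j : ℕ => if j = 0 then a else (m.choose j : ℚ⟦X⟧) * X ^ (m - j) *
      (∑ c : Composition j, (Nat.multinomial Finset.univ c.blocksFun : ℚ⟦X⟧) * g j c) * b) m]
  obtain ⟨n, rfl⟩ := Nat.exists_eq_add_of_le' hm
  have hrange : Finset.range (n + 1) = insert 0 (Finset.Ioo 0 (n + 1)) := by
    ext j; simp
  rw [hrange, Finset.sum_insert (by simp), if_pos rfl, Finset.sum_mul]
  congr 1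
  refine Finset.sum_congr rfl fun j hj => ?_
  rw [if_neg (Finset.mem_Ioo.1 hj).1.ne']

/-- The sum over ordered partitions of `m` in the formula for `P_m`. -/
noncomputable def compSum (m : ℕ) : ℚ⟦X⟧ :=
  ∑ c : Composition m, (Nat.multinomial Finset.univ c.blocksFun : ℚ⟦X⟧) * summand c

/-- The corresponding sum of the contributions `headSummand`. -/
noncomputable def headSum (m : ℕ) : ℚ⟦X⟧ :=
  ∑ c : Composition m, (Nat.multinomial Finset.univ c.blocksFun : ℚ⟦X⟧) * headSummand c

theorem compSum_eq {m : ℕ} (hm : 1 ≤ m) : compSum m = V m * R m +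
    (∑ j ∈ Finset.Ioo 0 m, (m.choose j : ℚ⟦X⟧) * X ^ (m - j) * headSum j) * R m :=
  sum_composition_eq hm _ (fun _ => headSummand) _ _ summand_appendLast_of_eq_zero
    summand_appendLast

theorem headSum_eq {m : ℕ} (hm : 1 ≤ m) : headSum m = V m * R m +
    (∑ j ∈ Finset.Ioo 0 m, (m.choose j : ℚ⟦X⟧) * X ^ (m - j) * headSum j) * (R m - 1) :=
  sum_composition_eq hm _ (fun _ => headSummand) _ _ headSummand_appendLast_of_eq_zero
    headSummand_appendLast

theorem headSum_eq_add_mul_compSum {m : ℕ} (hm : 1 ≤ m) :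
    headSum m = V m + X ^ 2 * (1 + 2 * X) ^ m * compSum m := by
  rw [headSum_eq hm, compSum_eq hm]
  linear_combination
    (V m + ∑ j ∈ Finset.Ioo 0 m, (m.choose j : ℚ⟦X⟧) * X ^ (m - j) * headSum j) *
      R_functional_equation m

theorem Ioc_zero_eq_insert {m : ℕ} (hm : 1 ≤ m) :
    Finset.Ioc 0 m = insert m (Finset.Ioo 0 m) := by
  ext j; simp; omega

/-- In this form the auxiliary sums `headSum` are eliminated, and `compSum` is expressed through its
own values. -/
theorem compSum_recursion {m : ℕ} (hm : 1 ≤ m) :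
    compSum m = ∑ j ∈ Finset.Ioc 0 m, (m.choose j : ℚ⟦X⟧) * X ^ (m - j) *
      (V j + X ^ 2 * (1 + 2 * X) ^ j * compSum j) := by
  have h : ∀ j ∈ Finset.Ioc 0 m, (m.choose j : ℚ⟦X⟧) * X ^ (m - j) *
      (V j + X ^ 2 * (1 + 2 * X) ^ j * compSum j) =
      (m.choose j : ℚ⟦X⟧) * X ^ (m - j) * headSum j := fun j hj => by
    rw [headSum_eq_add_mul_compSum (Finset.mem_Ioc.1 hj).1]
  rw [Finset.sum_congr rfl h, Ioc_zero_eq_insert hm, Finset.sum_insert (by simp), headSum_eq hm,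
    compSum_eq hm]
  simp
  ring

/-! ### The formula for the positive series -/

theorem P_zero : P 0 = 1 := by
  rw [P_eq_posSeries, posSeries, genFun_fintype]
  have h : ∀ v : Fin 0 → ℤ, len v = 0 := fun v => by simpa using len_le_sum v
  have hc : Fintype.card (PosVec (Fin 0)) = 1 := Fintype.card_eq_one_iff.2
    ⟨⟨0, fun i => i.elim0⟩, fun v => Subtype.ext (Subsingleton.elim _ _)⟩
  simp [h, hc]

/-- The series `P_m - U_m` satisfies the same recursion as the sum over ordered partitions. -/
theorem P_sub_recursion (m : ℕ) :
    P m - X ^ m = ∑ j ∈ Finset.Ioc 0 m, (m.choose j : ℚ⟦X⟧) * X ^ (m - j) *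
      (V j + X ^ 2 * (1 + 2 * X) ^ j * (P j - X ^ j)) := by
  have hbinom : (X + X ^ 2 : ℚ⟦X⟧) ^ m =
      ∑ j ∈ Finset.range (m + 1), (m.choose j : ℚ⟦X⟧) * X ^ (m - j) * X ^ (2 * j) := by
    rw [add_comm, add_pow]
    exact Finset.sum_congr rfl fun j _ => by rw [← pow_mul]; ring
  have h := P_recursion m
  have hterm : ∀ j, (m.choose j : ℚ⟦X⟧) * (P j * (1 + 2 * X) ^ j * X ^ (2 + (m - j))) =
      (m.choose j : ℚ⟦X⟧) * X ^ (m - j) * (V j + X ^ 2 * (1 + 2 * X) ^ j * (P j - X ^ j)) -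
      (1 - X ^ 2) * ((m.choose j : ℚ⟦X⟧) * X ^ (m - j) * X ^ (2 * j)) := fun j => by
    rw [V_eq]
    ring
  have hrange : Finset.range (m + 1) = insert 0 (Finset.Ioc 0 m) := by
    ext j; simp
  rw [Finset.sum_congr rfl fun j _ => hterm j, Finset.sum_sub_distrib, ← Finset.mul_sum, ← hbinom,
    hrange, Finset.sum_insert (by simp), P_zero, V_eq] at h
  simp only [Nat.choose_zero_right, Nat.cast_one, Nat.sub_zero, pow_zero, mul_zero, zero_add,
    sub_self] at h
  linear_combination h

theorem one_sub_ne_zero (k : ℕ) : (1 - X ^ 2 * (1 + 2 * X) ^ k : ℚ⟦X⟧) ≠ 0 :=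
  left_ne_zero_of_mul_eq_one (one_sub_mul_R k)

/-- The recursion of `compSum_recursion` and `P_sub_recursion` determines a sequence of series,
since the coefficient `1 - X ^ 2 * (1 + 2 * X) ^ m` of its leading term is nonzero. -/
theorem P_eq {m : ℕ} (hm : 1 ≤ m) : P m = X ^ m + compSum m := by
  suffices P m - X ^ m = compSum m by rw [← this]; ring
  induction m using Nat.strong_induction_on with
  | _ m ih =>
    have h1 := P_sub_recursion m
    have h2 := compSum_recursion hm
    rw [Ioc_zero_eq_insert hm, Finset.sum_insert (by simp)] at h1 h2
    rw [Finset.sum_congr rfl fun j hj => by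
      rw [ih j (Finset.mem_Ioo.1 hj).2 (Finset.mem_Ioo.1 hj).1]] at h1
    rw [Nat.choose_self, Nat.sub_self] at h1 h2
    refine mul_left_cancel₀ (one_sub_ne_zero m) ?_
    linear_combination h1 - h2

/-! ### Rationality -/

theorem IsRational.coe (p : Polynomial ℚ) : IsRational (p : ℚ⟦X⟧) :=
  ⟨p, 1, by simp, by simp⟩

theorem IsRational.add {f g : ℚ⟦X⟧} (hf : IsRational f) (hg : IsRational g) :
    IsRational (f + g) := by
  obtain ⟨p, q, hq, h⟩ := hf
  obtain ⟨p', q', hq', h'⟩ := hg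
  refine ⟨p * q' + p' * q, q * q', by simp [Polynomial.mul_coeff_zero, hq, hq'], ?_⟩
  push_cast
  linear_combination (q' : ℚ⟦X⟧) * h + (q : ℚ⟦X⟧) * h'

theorem IsRational.mul {f g : ℚ⟦X⟧} (hf : IsRational f) (hg : IsRational g) :
    IsRational (f * g) := by
  obtain ⟨p, q, hq, h⟩ := hf
  obtain ⟨p', q', hq', h'⟩ := hg
  refine ⟨p * p', q * q', by simp [Polynomial.mul_coeff_zero, hq, hq'], ?_⟩
  push_cast
  linear_combination (q' : ℚ⟦X⟧) * g * h + (p : ℚ⟦X⟧) * h'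

theorem IsRational.sum {ι : Type*} (s : Finset ι) (f : ι → ℚ⟦X⟧) (h : ∀ i ∈ s, IsRational (f i)) :
    IsRational (∑ i ∈ s, f i) :=
  Finset.sum_induction f IsRational (fun _ _ => IsRational.add) (by simpa using IsRational.coe 0) h

theorem IsRational.prod {ι : Type*} (s : Finset ι) (f : ι → ℚ⟦X⟧)
    (h : ∀ i ∈ s, IsRational (f i)) : IsRational (∏ i ∈ s, f i) :=
  Finset.prod_induction f IsRational (fun _ _ => IsRational.mul) (by simpa using IsRational.coe 1) h

theorem isRational_U (k : ℕ) : IsRational (U k) := by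
  simpa [U_eq] using IsRational.coe (Polynomial.X ^ k)

theorem isRational_V (k : ℕ) : IsRational (V k) := by
  have h2 : ((2 : Polynomial ℚ) : ℚ⟦X⟧) = 2 := map_ofNat Polynomial.coeToPowerSeries.ringHom 2
  have := (IsRational.coe (Polynomial.X ^ (2 * k))).add ((IsRational.coe
    (Polynomial.X ^ (k + 2) * (1 + 2 * Polynomial.X) ^ k)).add
      (IsRational.coe (-Polynomial.X ^ (2 * k + 2))))
  rw [V_eq, sub_eq_add_neg, add_assoc]
  simpa [h2] using this

theorem isRational_R (k : ℕ) : IsRational (R k) := by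
  have h2 : ((2 : Polynomial ℚ) : ℚ⟦X⟧) = 2 := map_ofNat Polynomial.coeToPowerSeries.ringHom 2
  refine ⟨1, 1 - Polynomial.X ^ 2 * (1 + 2 * Polynomial.X) ^ k, ?_, ?_⟩
  · simp [Polynomial.mul_coeff_zero]
  · simpa [h2] using one_sub_mul_R k

theorem isRational_summand {m : ℕ} (c : Composition m) : IsRational (summand c) := by
  have hR : ∀ k, IsRational (R k - 1) := fun k => by
    simpa [sub_eq_add_neg] using (isRational_R k).add (IsRational.coe (-1))
  rw [summand]
  split_ifs
  · exact (isRational_V m).mul (isRational_R m)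
  · exact (((isRational_V _).mul (isRational_R _)).mul
      (.prod _ _ fun k _ => (isRational_U _).mul (hR _))).mul
        ((isRational_U _).mul (isRational_R m))

theorem isRational_P {m : ℕ} (hm : 1 ≤ m) : IsRational (P m) := by
  rw [P_eq hm, ← U_eq]
  refine (isRational_U m).add (.sum _ _ fun c _ => .mul ?_ (isRational_summand c))
  have h : ∀ n : ℕ, ((n : Polynomial ℚ) : ℚ⟦X⟧) = n :=
    map_natCast Polynomial.coeToPowerSeries.ringHom
  exact h _ ▸ IsRational.coe _

end CubingHNN

theorem mainTheorem4 :
    -- the ingredients, explicitly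
    (∀ k : ℕ, 1 ≤ k →
      CubingHNN.U k = (X : ℚ⟦X⟧) ^ k ∧
      CubingHNN.V k = (X : ℚ⟦X⟧) ^ (2 * k) + X ^ (k + 2) * (1 + 2 * X) ^ k - X ^ (2 * k + 2) ∧
      CubingHNN.R k = (1 - (X : ℚ⟦X⟧) ^ 2 * (1 + 2 * X) ^ k)⁻¹) ∧
    (∀ m : ℕ, 1 ≤ m →
      -- the formula for the positive series
      CubingHNN.P m = CubingHNN.U m +
        ∑ c : Composition m,
          (Nat.multinomial Finset.univ c.blocksFun : ℚ⟦X⟧) * CubingHNN.summand c ∧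
      -- rationality
      CubingHNN.IsRational (CubingHNN.P m)) := by
  refine ⟨fun k _ => ⟨CubingHNN.U_eq k, CubingHNN.V_eq k, CubingHNN.R_eq k⟩, fun m hm => ⟨?_, ?_⟩⟩
  · rw [CubingHNN.P_eq hm, CubingHNN.U_eq]
    rfl
  · exact CubingHNN.isRational_P hm
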